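/- Let $B_3=\langle \sigma_1,\sigma_2 : \sigma_1\sigma_2\sigma_1=\sigma_2\sigma_1\sigma_2\rangle$ be the braid group on three strands and let $\Delta=\sigma_1\sigma_2\sigma_1$ be its Garside element, so that $\Delta^2$ is central. A positive half-twist in $B_3$ is a conjugate of $\sigma_1$. A factorization of $g\in B_3$ is a tuple $(g_1,\dots,g_k)$ of elements of $B_3$ with $g_1g_2\cdots g_k=g$. A Hurwitz move replaces two adjacent factors $(g_j,g_{j+1})$ of a factorization either by $(g_jg_{j+1}g_j^{-1},g_j)$ or by $(g_{j+1},g_{j+1}^{-1}g_jg_{j+1})$. Two factorizations of a central element are Hurwitz equivalent if one can be obtained from the other by a finite sequence of Hurwitz moves and global conjugation moves $(g_1,\dots,g_k)\mapsto(hg_1h^{-1},\dots,hg_kh^{-1})$ with $h\in B_3$. Theorem. Let $\mathcal F$ be a factorization of $\Delta^2$ in $B_3$ into three factors, of which, in some order, two are positive half-twists and one is the fourth power of a positive half-twist. Then $\mathcal F$ is Hurwitz equivalent to the factorization $(\sigma_1^4,\ \sigma_1^{-1}\sigma_2\sigma_1,\ \sigma_2^{-1}\sigma_1\sigma_2)$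 of $\Delta^2$. -/

import Mathlib

/-- The set of relators of the Artin presentation
`⟨σ₁, σ₂ : σ₁ σ₂ σ₁ = σ₂ σ₁ σ₂⟩` (the free generators are indexed by `0, 1 : Fin 2`). -/
def braidRelators : Set (FreeGroup (Fin 2)) :=
  {FreeGroup.of 0 * FreeGroup.of 1 * FreeGroup.of 0 *
    (FreeGroup.of 1 * FreeGroup.of 0 * FreeGroup.of 1)⁻¹}

/-- The braid group on three strands, given by its Artin presentation. -/
abbrev BraidGroup3 : Type := PresentedGroup braidRelators

namespace BraidGroup3

/-- The Artin generator `σ₁`. -/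
def σ₁ : BraidGroup3 := PresentedGroup.of 0

/-- The Artin generator `σ₂`. -/
def σ₂ : BraidGroup3 := PresentedGroup.of 1

/-- The Garside element `Δ = σ₁ σ₂ σ₁`. -/
def Δ : BraidGroup3 := σ₁ * σ₂ * σ₁

/-- Positive half-twists in the braid group: the conjugates of the Artin generator `σ₁`. -/
def IsPositiveHalfTwist (g : BraidGroup3) : Prop := IsConj σ₁ g

/-- `g` is the `e`-th power of a positive half-twist. -/
def IsPowerOfPositiveHalfTwist (e : ℕ) (g : BraidGroup3) : Prop :=
  ∃ h : BraidGroup3, IsPositiveHalfTwist h ∧ g = h ^ e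

end BraidGroup3

/-- The tuple `F` is a factorization of `g`: the ordered product of its entries is `g`. -/
def IsFactorization {G : Type*} [Group G] (g : G) (F : List G) : Prop := F.prod = g

/-- A Hurwitz move modifies two adjacent factors `a, b` to `a b a⁻¹, a` or to `b, b⁻¹ a b`. -/
inductive HurwitzMove {G : Type*} [Group G] : List G → List G → Prop
  | left (l r : List G) (a b : G) :
      HurwitzMove (l ++ a :: b :: r) (l ++ (a * b * a⁻¹) :: a :: r)
  | right (l r : List G) (a b : G) :
      HurwitzMove (l ++ a :: b :: r) (l ++ b :: (b⁻¹ * a * b) :: r)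

/-- A global conjugation move, available on factorizations of central elements,
conjugates all factors simultaneously by the same group element. -/
def GlobalConjugationMove {G : Type*} [Group G] (F F' : List G) : Prop :=
  F.prod ∈ Subgroup.center G ∧ ∃ h : G, F' = F.map (fun x => h * x * h⁻¹)

/-- Hurwitz equivalence: `F'` is obtained from `F` by a finite sequence of Hurwitz moves and,
when the factored element is central, global conjugation moves. -/
def HurwitzEquivalent {G : Type*} [Group G] : List G → List G → Prop :=
  Relation.ReflTransGen (fun F F' => HurwitzMove F F' ∨ GlobalConjugationMove F F')

open scoped MatrixGroups

namespace BraidGroup3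

/-! Hurwitz moves bring the fourth power to the front, and a global conjugation makes it `σ₁ ^ 4`.
The other two factors then multiply to `σ₁⁻⁴ Δ²`. In `SL(2, ℤ)` half-twists become transvections
along primitive vectors, and the resulting matrix equation forces these vectors to be `±(n, 1)` and
`±(n + 2, 1)` (`exists_of_transvection_mul`). A half-twist is determined by its vector up to sign,
because a braid preserving the line of the first basis vector commutes with `σ₁`
(`commute_σ₁_of_toSL`). So only the integer `n` is free, and conjugation by a power of `σ₁` removes
it.

The commutation lemma uses the structure of `B₃` modulo `Δ²`, which is generated by `Δ` of order 2
and `σ₁ σ₂` of order 3: alternating words in these are words in `σ₁` and `σ₂⁻¹`, whose matrices are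
nonnegative. -/

theorem braid_rel : σ₁ * σ₂ * σ₁ = σ₂ * σ₁ * σ₂ := by
  have h := PresentedGroup.one_of_mem (rels := braidRelators) (Set.mem_singleton _)
  rw [map_mul, map_inv, mul_inv_eq_one] at h
  exact h

theorem closure_generators : Subgroup.closure {σ₁, σ₂} = ⊤ := by
  rw [eq_top_iff, ← PresentedGroup.closure_range_of braidRelators, Subgroup.closure_le]
  rintro _ ⟨i, rfl⟩
  apply Subgroup.subset_closure
  fin_cases i
  · exact Or.inl rfl
  · exact Or.inr rfl

theorem Δ_mul_σ₁ : Δ * σ₁ = σ₂ * Δ := by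
  rw [Δ]; nth_rewrite 1 [braid_rel]; simp only [mul_assoc]

theorem Δ_mul_σ₂ : Δ * σ₂ = σ₁ * Δ := by
  rw [Δ]; nth_rewrite 2 [braid_rel]; simp only [mul_assoc]

theorem Δ_sq_mem_center : Δ ^ 2 ∈ Subgroup.center BraidGroup3 := by
  have h : Subgroup.closure {σ₁, σ₂} ≤ Subgroup.centralizer {Δ ^ 2} := by
    rw [Subgroup.closure_le]
    rintro g (rfl | rfl) <;>
      simp only [SetLike.mem_coe, Subgroup.mem_centralizer_singleton_iff]
    · rw [pow_two, mul_assoc, Δ_mul_σ₁, ← mul_assoc Δ σ₂, Δ_mul_σ₂, mul_assoc]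
    · rw [pow_two, mul_assoc, Δ_mul_σ₂, ← mul_assoc Δ σ₁, Δ_mul_σ₁, mul_assoc]
  rw [Subgroup.mem_center_iff]
  intro g
  have hg : g ∈ Subgroup.centralizer {Δ ^ 2} := h (by rw [closure_generators]; trivial)
  exact Subgroup.mem_centralizer_singleton_iff.mp hg

/-! ### The representation in `SL(2, ℤ)`. -/

/-- The images of the Artin generators in `SL(2, ℤ)`. -/
def slGenerators : Fin 2 → SL(2, ℤ) :=
  ![⟨!![1, 1; 0, 1], by simp⟩, ⟨!![1, 0; -1, 1], by simp⟩]

/-- The homomorphism from the braid group on three strands to `SL(2, ℤ)` which sends the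
Artin generators to the two standard transvections. -/
def toSL : BraidGroup3 →* SL(2, ℤ) :=
  PresentedGroup.toGroup (f := slGenerators) (rels := braidRelators) (by
    rintro r rfl
    simp only [map_mul, map_inv, FreeGroup.lift_apply_of, mul_inv_eq_one]
    apply Subtype.ext
    simp only [Matrix.SpecialLinearGroup.coe_mul, slGenerators]
    simp)

theorem toSL_σ₁ : (toSL σ₁ : Matrix (Fin 2) (Fin 2) ℤ) = !![1, 1; 0, 1] := by
  simp [toSL, σ₁, slGenerators]

theorem toSL_σ₂ : (toSL σ₂ : Matrix (Fin 2) (Fin 2) ℤ) = !![1, 0; -1, 1] := by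
  simp [toSL, σ₂, slGenerators]

theorem toSL_σ₂_inv : (toSL σ₂⁻¹ : Matrix (Fin 2) (Fin 2) ℤ) = !![1, 0; 1, 1] := by
  rw [map_inv, Matrix.SpecialLinearGroup.coe_inv, toSL_σ₂, Matrix.adjugate_fin_two_of]
  simp

theorem toSL_Δ : (toSL Δ : Matrix (Fin 2) (Fin 2) ℤ) = !![0, 1; -1, 0] := by
  simp [Δ, toSL_σ₁, toSL_σ₂]

theorem toSL_Δ_sq : toSL (Δ ^ 2) = -1 := by
  ext i j
  fin_cases i <;> fin_cases j <;> simp [pow_two, toSL_Δ]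

theorem toSL_Δ_sq_zpow (k : ℤ) : toSL ((Δ ^ 2) ^ k) = 1 ∨ toSL ((Δ ^ 2) ^ k) = -1 := by
  rw [map_zpow, toSL_Δ_sq]
  have h : (-1 : SL(2, ℤ)) * -1 = 1 := by simp
  obtain ⟨m, rfl | rfl⟩ := Int.even_or_odd' k
  · left; rw [zpow_mul, zpow_two, h, one_zpow]
  · right; rw [zpow_add, zpow_mul, zpow_two, h, one_zpow, one_mul, zpow_one]

theorem toSL_σ₁_zpow (n : ℤ) :
    (toSL (σ₁ ^ n) : Matrix (Fin 2) (Fin 2) ℤ) = !![1, n; 0, 1] := by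
  have step (g : BraidGroup3) (m : ℤ) (h : (toSL g : Matrix (Fin 2) (Fin 2) ℤ) = !![1, m; 0, 1]) :
      (toSL (g * σ₁) : Matrix (Fin 2) (Fin 2) ℤ) = !![1, m + 1; 0, 1] := by
    simp [h, toSL_σ₁, add_comm]
  have step' (g : BraidGroup3) (m : ℤ)
      (h : (toSL g : Matrix (Fin 2) (Fin 2) ℤ) = !![1, m; 0, 1]) :
      (toSL (g * σ₁⁻¹) : Matrix (Fin 2) (Fin 2) ℤ) = !![1, m - 1; 0, 1] := by
    rw [map_mul, map_inv, Matrix.SpecialLinearGroup.coe_mul, Matrix.SpecialLinearGroup.coe_inv,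
      toSL_σ₁, Matrix.adjugate_fin_two_of, h]
    simp [sub_eq_add_neg, add_comm]
  induction n using Int.induction_on with
  | zero => simp [Matrix.one_fin_two]
  | succ i ih => rw [zpow_add_one]; exact step _ _ ih
  | pred i ih => rw [zpow_sub_one]; exact step' _ _ ih

/-! ### Positivity of words in `σ₁` and `σ₂⁻¹`. -/

/-- The submonoid generated by `σ₁` and `σ₂⁻¹`, whose elements act on `ℤ²` by
matrices with nonnegative entries. -/
def alternatingMonoid : Submonoid BraidGroup3 := Submonoid.closure {σ₁, σ₂⁻¹}

theorem alternatingMonoid_cases {w : BraidGroup3} (hw : w ∈ alternatingMonoid) :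
    w = 1 ∨ (∃ w' ∈ alternatingMonoid, w = σ₁ * w') ∨
      ∃ w' ∈ alternatingMonoid, w = σ₂⁻¹ * w' := by
  induction hw using Submonoid.closure_induction_left with
  | one => exact Or.inl rfl
  | mul_left x hx y hy _ =>
    rcases hx with rfl | rfl
    · exact Or.inr (Or.inl ⟨y, hy, rfl⟩)
    · exact Or.inr (Or.inr ⟨y, hy, rfl⟩)

/-- Each letter adds one nonnegative coordinate to the other, and such a sum vanishes only if both
terms do. For a nonzero vector, a zero second coordinate therefore survives only the letters `σ₁`, a
zero first coordinate only the letters `σ₂⁻¹`. -/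
theorem alternatingMonoid_mulVec {w : BraidGroup3} (hw : w ∈ alternatingMonoid) {a b : ℤ}
    (ha : 0 ≤ a) (hb : 0 ≤ b) :
    (0 ≤ toSL w 0 0 * a + toSL w 0 1 * b ∧ 0 ≤ toSL w 1 0 * a + toSL w 1 1 * b) ∧
    (toSL w 1 0 * a + toSL w 1 1 * b = 0 → b = 0 ∧ (a = 0 ∨ ∃ n : ℕ, w = σ₁ ^ n)) ∧
    (toSL w 0 0 * a + toSL w 0 1 * b = 0 → a = 0 ∧ (b = 0 ∨ ∃ n : ℕ, w = σ₂⁻¹ ^ n)) := by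
  induction hw using Submonoid.closure_induction_left with
  | one =>
    simp only [map_one, Matrix.SpecialLinearGroup.coe_one, Matrix.one_apply_eq, one_mul,
      Matrix.one_apply_ne (zero_ne_one : (0 : Fin 2) ≠ 1), zero_mul, add_zero, zero_add,
      Matrix.one_apply_ne (one_ne_zero : (1 : Fin 2) ≠ 0)]
    exact ⟨⟨ha, hb⟩, fun h => ⟨h, Or.inr ⟨0, (pow_zero _).symm⟩⟩,
      fun h => ⟨h, Or.inr ⟨0, (pow_zero _).symm⟩⟩⟩
  | mul_left x hx y hy ih =>
    obtain ⟨⟨h0, h1⟩, hz1, hz0⟩ := ih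
    rcases hx with rfl | rfl
    · simp only [map_mul, Matrix.SpecialLinearGroup.coe_mul, toSL_σ₁, Matrix.mul_apply,
        Fin.sum_univ_two, Matrix.of_apply, Matrix.cons_val', Matrix.cons_val_zero,
        Matrix.cons_val_one, Matrix.cons_val_fin_one, one_mul, zero_mul, zero_add]
      refine ⟨⟨by linarith, h1⟩, fun h => ?_, fun h => ?_⟩
      · obtain ⟨hb, ha | ⟨n, rfl⟩⟩ := hz1 h
        · exact ⟨hb, Or.inl ha⟩
        · exact ⟨hb, Or.inr ⟨n + 1, (pow_succ' _ _).symm⟩⟩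
      · exact ⟨(hz0 (by linarith)).1, Or.inl (hz1 (by linarith)).1⟩
    · simp only [map_mul, Matrix.SpecialLinearGroup.coe_mul, toSL_σ₂_inv, Matrix.mul_apply,
        Fin.sum_univ_two, Matrix.of_apply, Matrix.cons_val', Matrix.cons_val_zero,
        Matrix.cons_val_one, Matrix.cons_val_fin_one, one_mul, zero_mul, add_zero]
      refine ⟨⟨h0, by linarith⟩, fun h => ?_, fun h => ?_⟩
      · exact ⟨(hz1 (by linarith)).1, Or.inl (hz0 (by linarith)).1⟩
      · obtain ⟨hb, ha | ⟨n, rfl⟩⟩ := hz0 h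
        · exact ⟨hb, Or.inl ha⟩
        · exact ⟨hb, Or.inr ⟨n + 1, (pow_succ' _ _).symm⟩⟩

/-! ### Normal form modulo powers of `Δ²`. -/

theorem σ₁σ₂_mul_Δ : σ₁ * σ₂ * Δ = Δ ^ 2 * σ₂⁻¹ := by
  rw [eq_mul_inv_iff_mul_eq, mul_assoc, Δ_mul_σ₂, ← mul_assoc, pow_two]; rfl

theorem σ₁σ₂_cube : (σ₁ * σ₂) ^ 3 = Δ ^ 2 := by
  have h : (σ₁ * σ₂) ^ 3 = σ₁ * σ₂ * σ₁ * (σ₂ * σ₁ * σ₂) := by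
    simp only [pow_succ, pow_zero, one_mul, mul_assoc]
  rw [h, ← braid_rel, pow_two]; rfl

/-- Modulo powers of `Δ ^ 2`, each braid on three strands is an alternating word, up to a
left factor in `{1, Δ}` and a right factor in `{1, σ₁ σ₂, (σ₁ σ₂) ^ 2}`. -/
def HasNormalForm (g : BraidGroup3) : Prop :=
  ∃ k : ℤ, ∃ s w t : BraidGroup3, (s = 1 ∨ s = Δ) ∧ w ∈ alternatingMonoid ∧
    (t = 1 ∨ t = σ₁ * σ₂ ∨ t = (σ₁ * σ₂) ^ 2) ∧ g = (Δ ^ 2) ^ k * (s * w * t)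

theorem mul_Δ_sq_zpow (g : BraidGroup3) (k : ℤ) : g * (Δ ^ 2) ^ k = (Δ ^ 2) ^ k * g :=
  Subgroup.mem_center_iff.mp (zpow_mem Δ_sq_mem_center k) g

theorem HasNormalForm.zpow_mul {g : BraidGroup3} (hg : HasNormalForm g) (j : ℤ) :
    HasNormalForm ((Δ ^ 2) ^ j * g) := by
  obtain ⟨k, s, w, t, hs, hw, ht, rfl⟩ := hg
  exact ⟨j + k, s, w, t, hs, hw, ht, by rw [← mul_assoc, zpow_add]⟩

theorem HasNormalForm.Δ_mul {g : BraidGroup3} (hg : HasNormalForm g) :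
    HasNormalForm (Δ * g) := by
  obtain ⟨k, s, w, t, hs, hw, ht, rfl⟩ := hg
  rw [← mul_assoc, mul_Δ_sq_zpow, mul_assoc]
  apply HasNormalForm.zpow_mul
  rcases hs with rfl | rfl
  · exact ⟨0, Δ, w, t, Or.inr rfl, hw, ht, by group⟩
  · exact ⟨1, 1, w, t, Or.inl rfl, hw, ht, by simp only [zpow_one, pow_two, one_mul, mul_assoc]⟩

/-- Modulo `Δ²`, left multiplication by `σ₁ σ₂` cycles the leading letter: `Δ` to `σ₂⁻¹` to `σ₁` to
`Δ`. If `s` and `w` are both trivial, it cycles `t` instead. -/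
theorem HasNormalForm.σ₁σ₂_mul {g : BraidGroup3} (hg : HasNormalForm g) :
    HasNormalForm (σ₁ * σ₂ * g) := by
  obtain ⟨k, s, w, t, hs, hw, ht, rfl⟩ := hg
  rw [← mul_assoc, mul_Δ_sq_zpow, mul_assoc]
  apply HasNormalForm.zpow_mul
  rcases hs with rfl | rfl
  · rcases alternatingMonoid_cases hw with rfl | ⟨w', hw', rfl⟩ | ⟨w', hw', rfl⟩
    · rcases ht with rfl | rfl | rfl
      · exact ⟨0, 1, 1, _, Or.inl rfl, one_mem _, Or.inr (Or.inl rfl), by group⟩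
      · exact ⟨0, 1, 1, _, Or.inl rfl, one_mem _, Or.inr (Or.inr rfl), by
          simp only [zpow_zero, pow_two, one_mul]⟩
      · refine ⟨1, 1, 1, 1, Or.inl rfl, one_mem _, Or.inl rfl, ?_⟩
        rw [zpow_one, one_mul, one_mul, mul_one, mul_one, ← σ₁σ₂_cube, pow_succ' _ 2]
    · exact ⟨0, Δ, w', t, Or.inr rfl, hw', ht, by rw [Δ]; group⟩
    · exact ⟨0, 1, σ₁ * w', t, Or.inl rfl,
        mul_mem (Submonoid.subset_closure (Or.inl rfl)) hw', ht, by group⟩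
  · refine ⟨1, 1, σ₂⁻¹ * w, t, Or.inl rfl,
        mul_mem (Submonoid.subset_closure (Or.inr rfl)) hw, ht, ?_⟩
    rw [← mul_assoc, ← mul_assoc, σ₁σ₂_mul_Δ]; group

theorem hasNormalForm (g : BraidGroup3) : HasNormalForm g := by
  -- Up to the central factor, the generators and their inverses are products of `Δ` and `σ₁ σ₂`, so
  -- the two multiplication lemmas suffice.
  have e1 : σ₁ = (Δ ^ 2) ^ (-1 : ℤ) * (σ₁ * σ₂ * (σ₁ * σ₂ * Δ)) := by
    rw [← mul_Δ_sq_zpow, σ₁σ₂_mul_Δ, ← Subgroup.mem_center_iff.mp Δ_sq_mem_center]; group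
  have e1' : σ₁⁻¹ = (Δ ^ 2) ^ (-1 : ℤ) * (Δ * (σ₁ * σ₂)) := by
    rw [eq_comm, zpow_neg_one, inv_mul_eq_iff_eq_mul, eq_mul_inv_iff_mul_eq, mul_assoc, pow_two]
    rfl
  have e2' : σ₂⁻¹ = (Δ ^ 2) ^ (-1 : ℤ) * (σ₁ * σ₂ * Δ) := by rw [σ₁σ₂_mul_Δ]; group
  have e2 : σ₂ = (Δ ^ 2) ^ (-1 : ℤ) * (Δ * (σ₁ * σ₂ * (σ₁ * σ₂))) := by
    rw [eq_comm, zpow_neg_one, inv_mul_eq_iff_eq_mul, pow_two, mul_assoc Δ Δ, mul_right_inj,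
      Δ_mul_σ₂, Δ, braid_rel]
    simp only [mul_assoc]
  have hg : g ∈ Subgroup.closure {σ₁, σ₂} := by rw [closure_generators]; trivial
  induction hg using Subgroup.closure_induction_left with
  | one => exact ⟨0, 1, 1, 1, Or.inl rfl, one_mem _, Or.inl rfl, by group⟩
  | mul_left x hx y _ ih =>
    rcases hx with rfl | rfl
    · rw [e1, mul_assoc, mul_assoc (σ₁ * σ₂), mul_assoc (σ₁ * σ₂)]
      exact (ih.Δ_mul.σ₁σ₂_mul.σ₁σ₂_mul).zpow_mul _
    · rw [e2, mul_assoc, mul_assoc, mul_assoc]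
      exact (ih.σ₁σ₂_mul.σ₁σ₂_mul.Δ_mul).zpow_mul _
  | inv_mul_cancel x hx y _ ih =>
    rcases hx with rfl | rfl
    · rw [e1', mul_assoc, mul_assoc]
      exact (ih.σ₁σ₂_mul.Δ_mul).zpow_mul _
    · rw [e2', mul_assoc, mul_assoc]
      exact (ih.Δ_mul.σ₁σ₂_mul).zpow_mul _

/-! ### Half-twists are determined by their vectors. -/

/-- A braid whose image in `SL(2, ℤ)` fixes the line through the first basis vector commutes
with `σ₁`. -/
theorem commute_σ₁_of_toSL {g : BraidGroup3} (hg : toSL g 1 0 = 0) : Commute g σ₁ := by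
  obtain ⟨k, s, w, t, hs, hw, ht, rfl⟩ := hasNormalForm g
  have hk : Commute ((Δ ^ 2) ^ k) σ₁ := (mul_Δ_sq_zpow σ₁ k).symm
  refine hk.mul_left ?_
  have hswt : toSL (s * w * t) 1 0 = 0 := by
    rw [map_mul] at hg
    rcases toSL_Δ_sq_zpow k with h | h <;> simpa [h] using hg
  rw [map_mul, map_mul, Matrix.SpecialLinearGroup.coe_mul, Matrix.SpecialLinearGroup.coe_mul,
    mul_assoc, Matrix.mul_apply, Fin.sum_univ_two, Matrix.mul_apply, Matrix.mul_apply,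
    Fin.sum_univ_two, Fin.sum_univ_two] at hswt
  have h10 := alternatingMonoid_mulVec hw (zero_le_one (α := ℤ)) le_rfl
  have h01 := alternatingMonoid_mulVec hw le_rfl (zero_le_one (α := ℤ))
  have h11 := alternatingMonoid_mulVec hw (zero_le_one (α := ℤ)) (zero_le_one (α := ℤ))
  simp only [mul_one, mul_zero, add_zero, zero_add, one_ne_zero, false_or, false_and,
    true_and, imp_false] at h10 h01 h11
  -- The three values of `t` send the first basis vector to `(1, 0)`, `(0, -1)`, `(-1, -1)`, and `Δ`
  -- swaps coordinates up to sign. Positivity of `w` leaves only `s = t = 1` and `s = Δ`, `t = σ₁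
  -- σ₂`.
  rcases hs with rfl | rfl <;> rcases ht with rfl | rfl | rfl
  · obtain ⟨n, rfl⟩ := h10.2.1 (by simpa using hswt)
    simp
  · exact absurd (by simpa [toSL_σ₁, toSL_σ₂] using hswt)
      h01.2.1
  · refine absurd ?_ h11.2.1
    simp [toSL_σ₁, toSL_σ₂, pow_two] at hswt
    linarith
  · exact absurd (by simpa [toSL_Δ] using hswt) h10.2.2
  · obtain ⟨n, rfl⟩ := h01.2.2
      (by simpa [toSL_Δ, toSL_σ₁, toSL_σ₂] using hswt)
    have h : Δ * σ₂⁻¹ = σ₁⁻¹ * Δ := by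
      rw [eq_inv_mul_iff_mul_eq, ← mul_assoc, ← Δ_mul_σ₂, mul_inv_cancel_right]
    have hn : Δ * σ₂⁻¹ ^ n = σ₁⁻¹ ^ n * Δ := SemiconjBy.pow_right h n
    have hΔ : Δ * (σ₁ * σ₂) = Δ ^ 2 * σ₁⁻¹ := by
      rw [eq_mul_inv_iff_mul_eq, mul_assoc, pow_two]; rfl
    rw [hn, mul_assoc, hΔ]
    have hc : Commute (Δ ^ 2) σ₁ := (Subgroup.mem_center_iff.mp Δ_sq_mem_center σ₁).symm
    have hi : Commute σ₁⁻¹ σ₁ := (Commute.refl σ₁).inv_left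
    exact (hi.pow_left n).mul_left (hc.mul_left hi)
  · refine absurd ?_ h11.2.2
    simp [toSL_Δ, toSL_σ₁, toSL_σ₂, pow_two] at hswt
    linarith

theorem toSL_conj_σ₁ (g : BraidGroup3) :
    (toSL (g * σ₁ * g⁻¹) : Matrix (Fin 2) (Fin 2) ℤ) =
      !![1 - toSL g 0 0 * toSL g 1 0, toSL g 0 0 ^ 2;
        -toSL g 1 0 ^ 2, 1 + toSL g 0 0 * toSL g 1 0] := by
  have hd := (toSL g).det_coe
  rw [Matrix.det_fin_two] at hd
  rw [map_mul, map_mul, map_inv, Matrix.SpecialLinearGroup.coe_mul,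
    Matrix.SpecialLinearGroup.coe_mul, Matrix.SpecialLinearGroup.coe_inv, toSL_σ₁,
    Matrix.adjugate_fin_two]
  ext i j
  fin_cases i <;> fin_cases j <;> simp [Matrix.mul_apply, Fin.sum_univ_two] <;> linarith

/-- A conjugate of `σ₁` is determined by the image of the conjugating braid on the first basis
vector, here in the case of a vector `± (n, 1)`. -/
theorem conj_σ₁_eq {g : BraidGroup3} {n : ℤ} (h : toSL g 0 0 = n * toSL g 1 0) :
    g * σ₁ * g⁻¹ = σ₁ ^ n * σ₂ * (σ₁ ^ n)⁻¹ := by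
  -- `σ₁ ^ n * Δ` sends the first basis vector to `-(n, 1)`, and it conjugates `σ₁` to the desired
  -- half-twist since `Δ σ₁ Δ⁻¹ = σ₂`.
  have hc : Commute ((σ₁ ^ n * Δ)⁻¹ * g) σ₁ := by
    apply commute_σ₁_of_toSL
    rw [map_mul, map_inv, Matrix.SpecialLinearGroup.coe_mul, Matrix.SpecialLinearGroup.coe_inv,
      map_mul, Matrix.SpecialLinearGroup.coe_mul, toSL_Δ, toSL_σ₁_zpow, Matrix.adjugate_fin_two]
    simp [Matrix.mul_apply, Fin.sum_univ_two, h]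
  have hc' : g * σ₁ * g⁻¹ = σ₁ ^ n * Δ * σ₁ * (σ₁ ^ n * Δ)⁻¹ := by
    rw [mul_inv_eq_iff_eq_mul, mul_assoc _ _ g]
    calc g * σ₁ = σ₁ ^ n * Δ * ((σ₁ ^ n * Δ)⁻¹ * g * σ₁) := by group
      _ = σ₁ ^ n * Δ * (σ₁ * ((σ₁ ^ n * Δ)⁻¹ * g)) := by rw [hc.eq]
      _ = _ := by simp only [mul_assoc]
  rw [hc', mul_assoc _ Δ, Δ_mul_σ₁]
  group

/-- The trace, `h₁ + h₄`, gives `(p s - q r)² = 4`. With either sign, `h₃` and `h₂` become the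
perfect squares `(q ± s)² = 0` and `(p ± r)² = 4`, whence `q = ±1`. -/
theorem exists_of_transvection_mul {p q r s : ℤ}
    (h₁ : (1 - p * q) * (1 - r * s) - p ^ 2 * s ^ 2 = -1)
    (h₂ : (1 - p * q) * r ^ 2 + p ^ 2 * (1 + r * s) = 4)
    (h₃ : q ^ 2 * (1 - r * s) + (1 + p * q) * s ^ 2 = 0)
    (h₄ : (1 + p * q) * (1 + r * s) - q ^ 2 * r ^ 2 = -1) :
    ∃ n : ℤ, p = n * q ∧ r = (n + 2) * s := by
  have hd : (p * s - q * r - 2) * (p * s - q * r + 2) = 0 := by linarith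
  rcases mul_eq_zero.mp hd with hd | hd
  · have hs : q + s = 0 := pow_eq_zero_iff (two_ne_zero) |>.mp
      (show (q + s) ^ 2 = 0 by linear_combination h₃ - q * s * hd)
    obtain rfl : s = -q := by linarith
    have hp : (p + r - 2) * (p + r + 2) = 0 := by linear_combination h₂ - p * r * hd
    rcases mul_eq_zero.mp hp with hp | hp
    · obtain rfl : r = 2 - p := by linarith
      obtain rfl : q = -1 := by linarith
      exact ⟨-p, by ring, by ring⟩
    · obtain rfl : r = -2 - p := by linarith
      obtain rfl : q = 1 := by linarith
      exact ⟨p, by ring, by ring⟩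
  · have hs : q - s = 0 := pow_eq_zero_iff (two_ne_zero) |>.mp
      (show (q - s) ^ 2 = 0 by linear_combination h₃ - q * s * hd)
    obtain rfl : s = q := by linarith
    have hp : (p - r - 2) * (p - r + 2) = 0 := by linear_combination h₂ - p * r * hd
    rcases mul_eq_zero.mp hp with hp | hp
    · obtain rfl : r = p - 2 := by linarith
      obtain rfl : s = -1 := by linarith
      exact ⟨-p, by ring, by ring⟩
    · obtain rfl : r = p + 2 := by linarith
      obtain rfl : s = 1 := by linarith
      exact ⟨p, by ring, by ring⟩

/-- The factorizations of `σ₁⁻⁴ Δ²` into two positive half-twists. -/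
theorem exists_eq_of_mul_eq {a b : BraidGroup3} (ha : IsPositiveHalfTwist a)
    (hb : IsPositiveHalfTwist b) (h : σ₁ ^ 4 * (a * b) = Δ ^ 2) :
    ∃ n : ℤ, a = σ₁ ^ n * σ₂ * (σ₁ ^ n)⁻¹ ∧ b = σ₁ ^ (n + 2) * σ₂ * (σ₁ ^ (n + 2))⁻¹ := by
  obtain ⟨x, rfl⟩ := isConj_iff.mp ha
  obtain ⟨y, rfl⟩ := isConj_iff.mp hb
  have hm : (toSL (x * σ₁ * x⁻¹) : Matrix (Fin 2) (Fin 2) ℤ) *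
      (toSL (y * σ₁ * y⁻¹) : Matrix (Fin 2) (Fin 2) ℤ) =
      !![-1, 4; 0, -1] := by
    have h' : x * σ₁ * x⁻¹ * (y * σ₁ * y⁻¹) = σ₁ ^ (-4 : ℤ) * Δ ^ 2 := by rw [← h]; group
    rw [← Matrix.SpecialLinearGroup.coe_mul, ← map_mul, h', map_mul, toSL_Δ_sq,
      Matrix.SpecialLinearGroup.coe_mul, toSL_σ₁_zpow, Matrix.SpecialLinearGroup.coe_neg,
      Matrix.SpecialLinearGroup.coe_one, mul_neg, mul_one]
    simp
  rw [toSL_conj_σ₁, toSL_conj_σ₁, Matrix.mul_fin_two] at hm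
  have e₁ := congrFun (congrFun hm 0) 0
  have e₂ := congrFun (congrFun hm 0) 1
  have e₃ := congrFun (congrFun hm 1) 0
  have e₄ := congrFun (congrFun hm 1) 1
  simp only [Matrix.of_apply, Matrix.cons_val', Matrix.cons_val_zero,
    Matrix.cons_val_one, Matrix.cons_val_fin_one] at e₁ e₂ e₃ e₄
  obtain ⟨n, hp, hr⟩ := exists_of_transvection_mul (p := toSL x 0 0) (q := toSL x 1 0)
    (r := toSL y 0 0) (s := toSL y 1 0) (by linarith) (by linarith) (by linarith) (by linarith)
  exact ⟨n, conj_σ₁_eq hp, conj_σ₁_eq hr⟩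

/-! ### Reduction to the standard factorization. -/

theorem IsPositiveHalfTwist.conj {a : BraidGroup3} (ha : IsPositiveHalfTwist a)
    (g : BraidGroup3) : IsPositiveHalfTwist (g * a * g⁻¹) :=
  IsConj.trans ha (isConj_iff.mpr ⟨g, rfl⟩)

theorem hurwitzEquivalent_of_power_first {a b c : BraidGroup3} (ha : IsPositiveHalfTwist a)
    (hb : IsPositiveHalfTwist b) (hc : IsPowerOfPositiveHalfTwist 4 c)
    (h : c * (a * b) = Δ ^ 2) :
    HurwitzEquivalent [c, a, b] [σ₁ ^ 4, σ₁⁻¹ * σ₂ * σ₁, σ₂⁻¹ * σ₁ * σ₂] := by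
  obtain ⟨d, hd, rfl⟩ := hc
  obtain ⟨g, rfl⟩ := isConj_iff.mp hd
  rw [conj_pow] at h ⊢
  have h' : σ₁ ^ 4 * (g⁻¹ * a * g⁻¹⁻¹ * (g⁻¹ * b * g⁻¹⁻¹)) = Δ ^ 2 := by
    have e := Subgroup.mem_center_iff.mp Δ_sq_mem_center g⁻¹
    rw [← h] at e ⊢
    rw [← mul_inv_eq_iff_eq_mul] at e
    rw [← e]
    group
  obtain ⟨n, han, hbn⟩ := exists_eq_of_mul_eq (ha.conj g⁻¹) (hb.conj g⁻¹) h'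
  have hσ : σ₂⁻¹ * σ₁ * σ₂ = σ₁ * σ₂ * σ₁⁻¹ := by
    rw [eq_mul_inv_iff_mul_eq, mul_assoc, mul_assoc, inv_mul_eq_iff_eq_mul, ← mul_assoc,
      ← mul_assoc, braid_rel]
  have ha' : a = g * (σ₁ ^ n * σ₂ * (σ₁ ^ n)⁻¹) * g⁻¹ := by rw [← han]; group
  have hb' : b = g * (σ₁ ^ (n + 2) * σ₂ * (σ₁ ^ (n + 2))⁻¹) * g⁻¹ := by rw [← hbn]; group
  -- After `g⁻¹`, conjugation by `σ₁ ^ (-(n + 1))` fixes `σ₁ ^ 4` and shifts the exponents `n`, `n +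
  -- 2` to `-1`, `1`; `hσ` then identifies the last factor.
  refine Relation.ReflTransGen.single (Or.inr ⟨?_, σ₁ ^ (-(n + 1)) * g⁻¹, ?_⟩)
  · simpa [h] using Δ_sq_mem_center
  · rw [hσ, ha', hb']
    simp only [List.map_cons, List.map_nil]
    congr 1
    · group
    congr 1
    · group
    congr 1
    group

end BraidGroup3

theorem HurwitzEquivalent.head_right {G : Type*} [Group G] {l r F : List G} {a b : G}
    (h : HurwitzEquivalent (l ++ b :: (b⁻¹ * a * b) :: r) F) :
    HurwitzEquivalent (l ++ a :: b :: r) F :=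
  Relation.ReflTransGen.head (Or.inl (HurwitzMove.right l r a b)) h

theorem mainTheorem9 (F : List BraidGroup3)
    (hF : IsFactorization (BraidGroup3.Δ ^ 2) F)
    (htypes : ∃ a b c : BraidGroup3,
      BraidGroup3.IsPositiveHalfTwist a ∧ BraidGroup3.IsPositiveHalfTwist b ∧
      BraidGroup3.IsPowerOfPositiveHalfTwist 4 c ∧ F.Perm [a, b, c]) :
    HurwitzEquivalent F
      [BraidGroup3.σ₁ ^ 4,
       BraidGroup3.σ₁⁻¹ * BraidGroup3.σ₂ * BraidGroup3.σ₁,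
       BraidGroup3.σ₂⁻¹ * BraidGroup3.σ₁ * BraidGroup3.σ₂] := by
  obtain ⟨a, b, c, ha, hb, hc, hp⟩ := htypes
  have hconj {x : BraidGroup3} (hx : BraidGroup3.IsPositiveHalfTwist x) :
      BraidGroup3.IsPositiveHalfTwist (c⁻¹ * x * c) := by
    simpa using hx.conj c⁻¹
  obtain ⟨l, r, rfl⟩ := List.append_of_mem (hp.mem_iff.mpr (by simp : c ∈ [a, b, c]))
  have hlr : (l ++ r).Perm [a, b] := by
    have h₁ : (c :: (l ++ r)).Perm [a, b, c] := List.perm_middle.symm.trans hp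
    exact (List.perm_cons c).mp (h₁.trans (List.perm_append_singleton c [a, b]))
  have hht : ∀ x ∈ l ++ r, BraidGroup3.IsPositiveHalfTwist x := by
    intro x hx
    rcases List.mem_pair.mp (hlr.mem_iff.mp hx) with rfl | rfl <;> assumption
  have hlen := hlr.length_eq
  unfold IsFactorization at hF
  match l, r, hlen with
  | [], [x, y], _ =>
    exact BraidGroup3.hurwitzEquivalent_of_power_first (hht x (by simp)) (hht y (by simp)) hc
      (by simpa using hF)
  | [x], [y], _ =>
    -- Moving `c` left past a half-twist leaves `c` intact and conjugates the half-twist by `c⁻¹`.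
    refine HurwitzEquivalent.head_right (l := []) (r := [y]) ?_
    refine BraidGroup3.hurwitzEquivalent_of_power_first (hconj (hht x (by simp)))
      (hht y (by simp)) hc ?_
    rw [← hF]
    simp [mul_assoc]
  | [x, y], [], _ =>
    refine HurwitzEquivalent.head_right (l := [x]) (r := []) ?_
    refine HurwitzEquivalent.head_right (l := []) (r := [c⁻¹ * y * c]) ?_
    refine BraidGroup3.hurwitzEquivalent_of_power_first (hconj (hht x (by simp)))
      (hconj (hht y (by simp))) hc ?_
    rw [← hF]
    simp [mul_assoc]
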